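/- Let $\ell$ be a prime and let $E/\mathbb{Q}$ and $E'/\mathbb{Q}$ be elliptic curves. Write $G_{\mathbb{Q}} = \operatorname{Gal}(\overline{\mathbb{Q}}/\mathbb{Q})$, let $T_\ell(E) = \varprojlim_n E[\ell^n]$ be the $\ell$-adic Tate module of $E$, where $E[\ell^n] \subseteq E(\overline{\mathbb{Q}})$, and let $\overline{\rho}_{E,\ell^\infty} \colon G_{\mathbb{Q}} \to \operatorname{Aut}_{\mathbb{Z}_\ell}(T_\ell(E)) \cong \operatorname{GL}(2,\mathbb{Z}_\ell)$ be the $\ell$-adic Galois representation attached to $E$, the last isomorphism being given by a choice of basis; similarly for $E'$. An isogeny over $\mathbb{Q}$ is a non-constant morphism $\phi \colon E \to E'$ of curves, defined over $\mathbb{Q}$, that maps the identity of $E$ to the identity of $E'$. A finite subgroup $H$ of $E(\overline{\mathbb{Q}})$ is called $\mathbb{Q}$-rational if $\sigma(H) = H$ for all $\sigma \in G_{\mathbb{Q}}$. Suppose that there is an isogeny $\phi \colon E \to E'$ over $\mathbb{Q}$ whose kernel (in $E(\overline{\mathbb{Q}})$) is a finite, cyclic, $\mathbb{Q}$-rational subgroup.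 Then $\overline{\rho}_{E,\ell^\infty}(G_{\mathbb{Q}})$ contains $-\operatorname{Id}$ if and only if $\overline{\rho}_{E',\ell^\infty}(G_{\mathbb{Q}})$ contains $-\operatorname{Id}$. This holds both for the images in $\operatorname{Aut}_{\mathbb{Z}_\ell}(T_\ell(E))$ and $\operatorname{Aut}_{\mathbb{Z}_\ell}(T_\ell(E'))$ and for the images in $\operatorname{GL}(2,\mathbb{Z}_\ell)$ with respect to any choice of $\mathbb{Z}_\ell$-bases of $T_\ell(E)$ and $T_\ell(E')$. -/

import Mathlib

open scoped WeierstrassCurve.Affine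

noncomputable section

namespace EllAdic

/-! ### The Tate module of an abelian group -/

/-- The `ℓ`-adic Tate module of an abelian group `A`: the inverse limit of the torsion subgroups
`A[ℓ ^ n]` along multiplication by `ℓ`, i.e. the group of sequences `(f n)` with `f n ∈ A[ℓ ^ n]`
and `ℓ • f (n + 1) = f n`. -/
def tateModule (ℓ : ℕ) (A : Type*) [AddCommGroup A] : AddSubgroup (ℕ → A) where
  carrier := {f | (∀ n, ℓ ^ n • f n = 0) ∧ ∀ n, ℓ • f (n + 1) = f n}
  zero_mem' := by simp
  add_mem' := by
    rintro f g ⟨hf, hf'⟩ ⟨hg, hg'⟩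
    exact ⟨fun n => by simp [hf, hg], fun n => by simp [hf', hg']⟩
  neg_mem' := by
    rintro f ⟨hf, hf'⟩
    exact ⟨fun n => by simp [hf], fun n => by simp [hf']⟩

/-- On an element killed by `N`, a natural number acts through its class in `ℤ / N`. -/
lemma nsmul_eq_of_cast_eq {A : Type*} [AddCommGroup A] {N : ℕ} {x : A} (hx : N • x = 0)
    {a b : ℕ} (h : (a : ZMod N) = b) : a • x = b • x := by
  have h' : a ≡ b [MOD addOrderOf x] :=
    ((ZMod.natCast_eq_natCast_iff a b N).1 h).of_dvd (addOrderOf_dvd_of_nsmul_eq_zero hx)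
  exact nsmul_eq_nsmul_iff_modEq.2 h'

section Module

variable {ℓ : ℕ} [Fact ℓ.Prime] {A : Type*} [AddCommGroup A]

lemma val_nsmul_eq {n : ℕ} {x : A} (hx : ℓ ^ n • x = 0) {a : ZMod (ℓ ^ n)} {b : ℕ}
    (h : a = b) : a.val • x = b • x :=
  nsmul_eq_of_cast_eq hx (by rw [ZMod.natCast_zmod_val, h])

/-- `ℤ_ℓ` acts on the `n`-th component, an element of `A[ℓ ^ n]`, through `ℤ / ℓ ^ n`. -/
instance : SMul ℤ_[ℓ] (tateModule ℓ A) where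
  smul a f := ⟨fun n => (PadicInt.toZModPow n a).val • f.1 n, by
    refine ⟨fun n => ?_, fun n => ?_⟩
    · rw [smul_comm, f.2.1 n, smul_zero]
    · rw [smul_comm, f.2.2 n]
      refine (val_nsmul_eq (f.2.1 n) ?_).symm
      rw [← PadicInt.cast_toZModPow n (n + 1) (Nat.le_succ n) a, ZMod.natCast_val]⟩

lemma smul_apply (a : ℤ_[ℓ]) (f : tateModule ℓ A) (n : ℕ) :
    (a • f).1 n = (PadicInt.toZModPow n a).val • f.1 n := rfl

instance : Module ℤ_[ℓ] (tateModule ℓ A) where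
  one_smul f := by
    ext n
    rw [smul_apply, val_nsmul_eq (f.2.1 n) (b := 1) (by simp), one_smul]
  mul_smul a b f := by
    ext n
    rw [smul_apply, smul_apply, smul_apply, smul_smul]
    exact val_nsmul_eq (f.2.1 n) (by simp)
  smul_zero a := by
    ext n
    simp [smul_apply]
  smul_add a f g := by
    ext n
    simp [smul_apply]
  add_smul a b f := by
    ext n
    rw [AddSubgroup.coe_add, Pi.add_apply, smul_apply, smul_apply, smul_apply, ← add_smul]
    exact val_nsmul_eq (f.2.1 n) (by simp)
  zero_smul f := by
    ext n
    simp [smul_apply]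

/-- A homomorphism of abelian groups acts componentwise on Tate modules. -/
def tateMap {B : Type*} [AddCommGroup B] (g : A →+ B) :
    tateModule ℓ A →ₗ[ℤ_[ℓ]] tateModule ℓ B where
  toFun f := ⟨fun n => g (f.1 n), fun n => by rw [← map_nsmul, f.2.1, map_zero],
    fun n => by rw [← map_nsmul, f.2.2]⟩
  map_add' f f' := by
    ext n
    simp
  map_smul' a f := by
    ext n
    simp [smul_apply]

end Module

/-! ### Elliptic curves over `ℚ` and their `ℓ`-adic Galois representations -/

/-- A fixed algebraic closure of `ℚ`. -/
abbrev Qbar : Type := AlgebraicClosure ℚ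

instance : DecidableEq Qbar := Classical.decEq _

/-- The absolute Galois group `G_ℚ = Gal(ℚ̄ / ℚ)`. -/
abbrev GQ : Type := Qbar ≃ₐ[ℚ] Qbar

/-- The group `E(ℚ̄)` of an elliptic curve `E` over `ℚ`. -/
abbrev Pts (E : WeierstrassCurve ℚ) : Type := (E⁄Qbar).Point

/-- The action of `σ ∈ G_ℚ` on `E(ℚ̄)`, through the coordinates. -/
def galPt (E : WeierstrassCurve ℚ) (σ : GQ) : Pts E →+ Pts E :=
  WeierstrassCurve.Affine.Point.map (W' := E) σ.toAlgHom

/-- The `ℓ`-adic Tate module `T_ℓ(E) = lim E[ℓ ^ n]`, with `E[ℓ ^ n] ⊆ E(ℚ̄)`. -/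
abbrev Tate (E : WeierstrassCurve ℚ) (ℓ : ℕ) : Type := tateModule ℓ (Pts E)

/-- The Galois action on `T_ℓ(E)`, as a homomorphism to the monoid of `ℤ_ℓ`-endomorphisms. -/
def galEnd (E : WeierstrassCurve ℚ) (ℓ : ℕ) [Fact ℓ.Prime] :
    GQ →* Module.End ℤ_[ℓ] (Tate E ℓ) where
  toFun σ := tateMap (galPt E σ)
  map_one' := by
    ext f n
    change galPt E 1 (f.1 n) = f.1 n
    cases f.1 n <;> rfl
  map_mul' σ τ := by
    ext f n
    change galPt E (σ * τ) (f.1 n) = galPt E σ (galPt E τ (f.1 n))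
    cases f.1 n <;> rfl

/-- The `ℓ`-adic Galois representation `ρ_{E, ℓ^∞} : G_ℚ → Aut(T_ℓ(E))`. -/
def adicRep (E : WeierstrassCurve ℚ) (ℓ : ℕ) [Fact ℓ.Prime] :
    GQ →* LinearMap.GeneralLinearGroup ℤ_[ℓ] (Tate E ℓ) :=
  (galEnd E ℓ).toHomUnits

/-- The `ℓ`-adic Galois representation `ρ_{E, ℓ^∞} : G_ℚ → GL(2, ℤ_ℓ)` with respect to a basis of
`T_ℓ(E)`; the columns of the matrices are the coordinates of the images of the basis vectors. -/
def adicRepMatrix (E : WeierstrassCurve ℚ) (ℓ : ℕ) [Fact ℓ.Prime]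
    (b : Module.Basis (Fin 2) ℤ_[ℓ] (Tate E ℓ)) : GQ →* Matrix.GeneralLinearGroup (Fin 2) ℤ_[ℓ] :=
  (Units.map (LinearMap.toMatrixAlgEquiv b : _ →* Matrix (Fin 2) (Fin 2) ℤ_[ℓ])).comp (adicRep E ℓ)

/-! ### Isogenies over `ℚ` -/

/-- Homogeneous coordinates of a point of `E ⊆ ℙ²`: `[0 : 1 : 0]` for the identity and
`[x : y : 1]` for an affine point `(x, y)`. -/
def homCoords {E : WeierstrassCurve ℚ} : Pts E → Fin 3 → Qbar
  | .zero => ![0, 1, 0]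
  | .some x y _ => ![x, y, 1]

/-- `φ : E(ℚ̄) → E'(ℚ̄)` is a morphism of projective curves defined over `ℚ`: around every point
`P` it is of the form `[F₀ : F₁ : F₂]` for homogeneous polynomials `F₀, F₁, F₂` over `ℚ` of the
same degree which do not vanish simultaneously at `P`. -/
def IsMorphism {E E' : WeierstrassCurve ℚ} (φ : Pts E → Pts E') : Prop :=
  ∀ P : Pts E, ∃ (d : ℕ) (F : Fin 3 → MvPolynomial (Fin 3) ℚ),
    (∀ i, (F i).IsHomogeneous d) ∧
    (∃ i, MvPolynomial.aeval (homCoords P) (F i) ≠ 0) ∧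
    ∀ Q : Pts E, (∃ i, MvPolynomial.aeval (homCoords Q) (F i) ≠ 0) →
      ∃ c : Qbar, c ≠ 0 ∧
        ∀ i, MvPolynomial.aeval (homCoords Q) (F i) = c * homCoords (φ Q) i

/-- An isogeny over `ℚ`: a non-constant morphism `E → E'` defined over `ℚ` which maps the identity
to the identity, given by its values on `ℚ̄`-points. -/
structure Isogeny (E E' : WeierstrassCurve ℚ) where
  toFun : Pts E → Pts E'
  isMorphism : IsMorphism toFun
  map_zero : toFun 0 = 0
  nonconstant : ∃ P Q : Pts E, toFun P ≠ toFun Q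

/-- The kernel of an isogeny, as a set of `ℚ̄`-points. -/
def Isogeny.ker {E E' : WeierstrassCurve ℚ} (φ : Isogeny E E') : Set (Pts E) :=
  {P | φ.toFun P = 0}

/-- A subgroup `H` of `E` is `ℚ`-rational if `σ(H) = H` for all `σ ∈ G_ℚ`. -/
def IsRational {E : WeierstrassCurve ℚ} (H : AddSubgroup (Pts E)) : Prop :=
  ∀ σ : GQ, H.map (galPt E σ) = H

end EllAdic

end

/-! ### The affine coordinate ring: points as maximal ideals, Dedekind property. -/

open scoped WeierstrassCurve.Affine Polynomial.Bivariate

noncomputable section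

open Polynomial

/-! On points over `Qbar` the isogeny φ is a surjective homomorphism with finite kernel, and it
commutes with Galois because its charts have rational coefficients. With N the order of the kernel,
the induced map on Tate modules is injective and its image contains N · T_ℓ(E'). Both Tate modules
are torsion-free, so a given σ acts as -1 on one exactly when it does on the other
(`tateMap_eq_neg_iff`): the same σ serves both curves. Any basis turns -1 into the matrix -1, which
gives the matrix version.

The real work is to show that a map known only through local charts by forms is additive and
surjective. Over an algebraically closed field K of characteristic zero, put R = K[E], R' = K[E']
and F = K(E). Sending a point to the class of its ideal in R (the unit ideal at infinity) is an
injective homomorphism to the class group. Evaluating a chart at the generic point embeds R' into F,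
and reducing projective coordinates modulo valuation rings of F relates this embedding to the values
of φ (`IsRegularMap.exists_comorphism`). Since φ(0) = 0, a valuation ring containing R' contains R,
so R lies in the integral closure S of R' in F. Then I ↦ relNorm(I S) is multiplicative, keeps
principal ideals principal, and takes the ideal of P to that of φ(P) (`exists_idealNorm`,
`IsRegularMap.exists_pushforward`). Applied to the ideal relation that expresses P + Q, it gives
additivity. For surjectivity, a valuation ring dominating the ideal of a target point cuts out on R
the ideal of a preimage. -/

/-- If `M * J` is a nonzero principal ideal, then `M` is principal locally at `M`. -/
lemma Ideal.exists_dvd_mul_of_mul_eq_span {A : Type*} [CommRing A] [IsDomain A] {M J : Ideal A}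
    (hM : M ≠ ⊤) {f : A} (hf : f ≠ 0) (h : M * J = Ideal.span {f}) :
    ∃ a ∈ M, ∃ c ∉ M, ∀ x ∈ M, a ∣ x * c := by
  -- Otherwise M J ⊆ f M, so f = f z with z ∈ M, forcing 1 ∈ M.
  have key : ∃ a ∈ M, ∃ j ∈ J, ∃ c ∉ M, a * j = f * c := by
    by_contra! H
    refine hM ((Ideal.eq_top_iff_one _).2 ?_)
    have hle : M * J ≤ Ideal.span {f} * M := by
      refine Ideal.mul_le.2 fun a ha j hj => ?_
      obtain ⟨c, hc⟩ := Ideal.mem_span_singleton.1 (h ▸ Ideal.mul_mem_mul ha hj)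
      have : c ∈ M := by
        by_contra hcM
        exact H a ha j hj c hcM hc
      exact hc ▸ Ideal.mul_mem_mul (Ideal.mem_span_singleton_self f) this
    obtain ⟨z, hz, hz'⟩ := Ideal.mem_span_singleton_mul.1
      (hle (h ▸ Ideal.mem_span_singleton_self f))
    rwa [mul_right_eq_self₀.1 hz' |>.resolve_right hf] at hz
  obtain ⟨a, ha, j, hj, c, hc, hac⟩ := key
  refine ⟨a, ha, c, hc, fun x hx => ?_⟩
  obtain ⟨d, hd⟩ := Ideal.mem_span_singleton.1 (h ▸ Ideal.mul_mem_mul hx hj)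
  refine ⟨d, mul_left_cancel₀ hf ?_⟩
  linear_combination -x * hac + a * hd

/-- Over an algebraically closed field, every residue field of a finitely generated algebra is the
base field. -/
lemma Ideal.IsMaximal.bijective_algebraMap_quotient {K A : Type*} [Field K] [IsAlgClosed K]
    [CommRing A] [Algebra K A] [Algebra.FiniteType K A] {M : Ideal A} (hM : M.IsMaximal) :
    Function.Bijective (algebraMap K (A ⧸ M)) := by
  let := Ideal.Quotient.field M
  have : Module.Finite K (A ⧸ M) := finite_of_finite_type_of_isJacobsonRing K (A ⧸ M)
  exact IsAlgClosed.algebraMap_bijective_of_isIntegral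

namespace WeierstrassCurve.Affine

variable {K : Type*} [Field K] (W : WeierstrassCurve.Affine K)

namespace CoordinateRing

/-- The coordinate function `x`. -/
def xGen : W.CoordinateRing := mk W (C X)

/-- The coordinate function `y`. -/
def yGen : W.CoordinateRing := mk W Y

instance : Algebra.FiniteType K W.CoordinateRing :=
  .trans (S := K[X]) inferInstance inferInstance

instance : IsNoetherianRing W.CoordinateRing :=
  Algebra.FiniteType.isNoetherianRing K _

instance : Module.Finite K[X] W.CoordinateRing :=
  .of_basis (CoordinateRing.basis W)

instance : Ring.DimensionLEOne W.CoordinateRing :=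
  .of_isIntegral K[X] _

lemma XClass_eq (x : K) : XClass W x = xGen W - algebraMap K _ x := by
  simp [XClass, xGen, C_sub]; rfl

lemma YClass_eq (y : K) : YClass W (C y) = yGen W - algebraMap K _ y := by
  simp [YClass, yGen]; rfl


variable {W} in
/-- The algebra homomorphism out of the coordinate ring given by a solution of the equation. -/
def lift {L : Type*} [CommRing L] [Algebra K L] (x y : L)
    (h : y ^ 2 + algebraMap K L W.a₁ * x * y + algebraMap K L W.a₃ * y =
      x ^ 3 + algebraMap K L W.a₂ * x ^ 2 + algebraMap K L W.a₄ * x + algebraMap K L W.a₆) :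
    W.CoordinateRing →ₐ[K] L :=
  AdjoinRoot.liftAlgHom _ (aeval x) y (by
    simp only [WeierstrassCurve.Affine.polynomial, eval₂_sub, eval₂_add, eval₂_mul, eval₂_pow,
      eval₂_X, eval₂_C, RingHom.coe_coe, map_add, map_mul, map_pow, aeval_X, aeval_C]
    linear_combination h)

section lift

variable {W} {L : Type*} [CommRing L] [Algebra K L] {x y : L}
    (h : y ^ 2 + algebraMap K L W.a₁ * x * y + algebraMap K L W.a₃ * y =
      x ^ 3 + algebraMap K L W.a₂ * x ^ 2 + algebraMap K L W.a₄ * x + algebraMap K L W.a₆)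

@[simp]
lemma lift_xGen : lift x y h (xGen W) = x := by
  simp [lift, xGen]

@[simp]
lemma lift_yGen : lift x y h (yGen W) = y := by
  simp [lift, yGen]

end lift

lemma adjoin_xGen_yGen : Algebra.adjoin K {xGen W, yGen W} = ⊤ := by
  refine eq_top_iff.2 fun r _ => ?_
  have hX (p : K[X]) : mk W (C p) ∈ Algebra.adjoin K {xGen W, yGen W} := by
    induction p using Polynomial.induction_on' with
    | add p q hp hq => simpa using add_mem hp hq
    | monomial n a =>
      rw [← C_mul_X_pow_eq_monomial, C_mul, C_pow, map_mul, map_pow]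
      exact mul_mem (Subalgebra.algebraMap_mem _ a)
        (pow_mem (Algebra.subset_adjoin (Set.mem_insert _ _)) n)
  obtain ⟨p, q, rfl⟩ := exists_smul_basis_eq r
  rw [smul, smul, mul_one]
  exact add_mem (hX p) (mul_mem (hX q)
    (Algebra.subset_adjoin (Set.mem_insert_of_mem _ rfl)))

lemma xGen_yGen_equation : yGen W ^ 2 + algebraMap K _ W.a₁ * xGen W * yGen W +
      algebraMap K _ W.a₃ * yGen W =
    xGen W ^ 3 + algebraMap K _ W.a₂ * xGen W ^ 2 + algebraMap K _ W.a₄ * xGen W +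
      algebraMap K _ W.a₆ := by
  have h : mk W (Y ^ 2 + C (C W.a₁ * X + C W.a₃) * Y -
    C (X ^ 3 + C W.a₂ * X ^ 2 + C W.a₄ * X + C W.a₆)) = 0 := AdjoinRoot.mk_self
  simp only [map_add, map_sub, map_mul, map_pow] at h
  change yGen W ^ 2 + (algebraMap K W.CoordinateRing W.a₁ * xGen W +
    algebraMap K W.CoordinateRing W.a₃) * yGen W - (xGen W ^ 3 +
    algebraMap K W.CoordinateRing W.a₂ * xGen W ^ 2 + algebraMap K W.CoordinateRing W.a₄ * xGen W +
    algebraMap K W.CoordinateRing W.a₆) = 0 at h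
  linear_combination h

variable {W}

/-- Evaluation of functions at a point. -/
def evalAt {x y : K} (h : W.Equation x y) : W.CoordinateRing →ₐ[K] K :=
  lift x y (by simpa using (W.equation_iff x y).1 h)

lemma XYIdeal_isMaximal {x y : K} (h : W.Equation x y) : (XYIdeal W x (C y)).IsMaximal :=
  Ideal.Quotient.maximal_of_isField _ <|
    (quotientXYIdealEquiv (W' := W) h).toMulEquiv.isField (Field.toIsField K)

lemma XYIdeal_eq_ker {x y : K} (h : W.Equation x y) :
    XYIdeal W x (C y) = RingHom.ker (evalAt h) := by
  refine (XYIdeal_isMaximal h).eq_of_le (RingHom.ker_ne_top _) (Ideal.span_le.2 ?_)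
  rintro _ (rfl | rfl)
  · simp [XClass_eq, evalAt]
  · simp [YClass_eq, evalAt]

lemma mem_XYIdeal_iff {x y : K} (h : W.Equation x y) {r : W.CoordinateRing} :
    r ∈ XYIdeal W x (C y) ↔ evalAt h r = 0 := by
  rw [XYIdeal_eq_ker h, RingHom.mem_ker]

/-- Nullstellensatz: the residue field is K, and the residues of the two coordinate functions are
the coordinates of the point. -/
lemma exists_eq_XYIdeal [IsAlgClosed K] {M : Ideal W.CoordinateRing} (hM : M.IsMaximal) :
    ∃ x y, W.Equation x y ∧ M = XYIdeal W x (C y) := by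
  have hbij := hM.bijective_algebraMap_quotient (K := K)
  obtain ⟨x, hx⟩ := hbij.2 (Ideal.Quotient.mk M (xGen W))
  obtain ⟨y, hy⟩ := hbij.2 (Ideal.Quotient.mk M (yGen W))
  have heq : W.Equation x y := by
    rw [W.equation_iff]
    apply hbij.1
    have := congr_arg (Ideal.Quotient.mkₐ K M) (xGen_yGen_equation W)
    simp only [map_add, map_mul, map_pow, AlgHom.commutes, Ideal.Quotient.mkₐ_eq_mk, ← hx,
      ← hy] at this ⊢
    exact this
  refine ⟨x, y, heq, ((XYIdeal_isMaximal heq).eq_of_le hM.ne_top (Ideal.span_le.2 ?_)).symm⟩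
  rintro _ (rfl | rfl)
  · rw [SetLike.mem_coe, XClass_eq, ← Ideal.Quotient.eq_zero_iff_mem, map_sub, ← hx, sub_eq_zero]
    rfl
  · rw [SetLike.mem_coe, YClass_eq, ← Ideal.Quotient.eq_zero_iff_mem, map_sub, ← hy, sub_eq_zero]
    rfl

lemma XYIdeal_ne_bot {x y : K} : XYIdeal W x (C y) ≠ ⊥ := fun h =>
  XClass_ne_zero (W' := W) x (by
    rw [← Ideal.mem_bot, ← h]
    exact Ideal.subset_span (Set.mem_insert _ _))

/-- The coordinate ring of an elliptic curve over an algebraically closed field is a Dedekind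
domain. -/
instance isDedekindDomain [IsAlgClosed K] [W.IsElliptic] : IsDedekindDomain W.CoordinateRing := by
  suffices IsDedekindDomainDvr W.CoordinateRing from inferInstance
  refine { is_dvr_at_nonzero_prime := fun P hP hPp => ?_ }
  have hPm := hPp.isMaximal hP
  obtain ⟨x, y, h, rfl⟩ := exists_eq_XYIdeal hPm
  have hns := (W.equation_iff_nonsingular).1 h
  -- The ideals of P and -P multiply to the principal ideal of the vertical line through P, so the
  -- ideal of P is locally principal.
  obtain ⟨a, ha, c, hc, hac⟩ := Ideal.exists_dvd_mul_of_mul_eq_span hPm.ne_top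
    (XClass_ne_zero (W' := W) x) ((mul_comm _ _).trans (XYIdeal_neg_mul hns))
  have hf := IsLocalization.AtPrime.not_isField _ hP (Localization.AtPrime (XYIdeal W x (C y)))
  refine ((IsDiscreteValuationRing.TFAE _ hf).out 0 4).2 ?_
  refine ⟨algebraMap _ _ a, ?_⟩
  rw [← Localization.AtPrime.map_eq_maximalIdeal]
  refine le_antisymm (Ideal.map_le_iff_le_comap.2 fun z hz => ?_)
    ((Submodule.span_singleton_le_iff_mem _ _).2 (Ideal.mem_map_of_mem _ ha))
  have hu := IsLocalization.map_units (Localization.AtPrime (XYIdeal W x (C y)))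
    (⟨c, hc⟩ : (XYIdeal W x (C y)).primeCompl)
  refine Ideal.mem_span_singleton.2 ((hu.dvd_mul_right).1 ?_)
  rw [← map_mul]
  exact map_dvd _ (hac z hz)

end CoordinateRing
end WeierstrassCurve.Affine
end

/-! ### Valuation rings of the function field. -/

noncomputable section

namespace ValuationSubring

variable {F A : Type*} [Field F] [CommRing A] [Algebra A F]

/-- The valuation ring `V` contains the image of `A`, and its maximal ideal contains the image of
the ideal `I` of `A`. -/
def Dominates (V : ValuationSubring F) (I : Ideal A) : Prop :=
  (∀ a, V.valuation (algebraMap A F a) ≤ 1) ∧ ∀ a ∈ I, V.valuation (algebraMap A F a) < 1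

lemma Dominates.ne_top {V : ValuationSubring F} {I : Ideal A} (h : V.Dominates I) : I ≠ ⊤ := by
  rintro rfl
  simpa using h.2 1 trivial

lemma Dominates.lt_one_iff {V : ValuationSubring F} {I : Ideal A} (hI : I.IsMaximal)
    (h : V.Dominates I) {a : A} : V.valuation (algebraMap A F a) < 1 ↔ a ∈ I := by
  refine ⟨fun ha => ?_, h.2 a⟩
  by_contra haI
  obtain ⟨b, c, hc, hbc⟩ := hI.exists_inv haI
  have h1 : V.valuation (algebraMap A F (b * a)) < 1 := by
    rw [map_mul, map_mul]
    exact mul_lt_one_of_nonneg_of_lt_one_right (h.1 b) zero_le ha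
  have := V.valuation.map_add_lt h1 (h.2 c hc)
  rw [← map_add, hbc] at this
  simp at this

/-- Chevalley's extension theorem, applied to the image of A in F. -/
lemma exists_dominates [FaithfulSMul A F] {I : Ideal A} (hI : I ≠ ⊤) :
    ∃ V : ValuationSubring F, V.Dominates I := by
  let f := (algebraMap A F).rangeRestrict
  have hf : Function.Injective f := fun a b hab =>
    FaithfulSMul.algebraMap_injective A F (congr_arg Subtype.val hab)
  have hI' : I.map f ≠ ⊤ := fun h =>
    hI ((Ideal.map_eq_top_iff f hf
      (RingHom.isIntegral_of_surjective _ (RingHom.rangeRestrict_surjective _))).1 h)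
  obtain ⟨V, hV, hV'⟩ := Ideal.image_subset_nonunits_valuationSubring _ hI'
  refine ⟨V, fun a => (V.valuation_le_one_iff _).2 (hV ⟨a, rfl⟩), fun a ha => ?_⟩
  exact V.mem_nonunits_iff.1 (hV' ⟨f a, Ideal.mem_map_of_mem f ha, rfl⟩)

lemma valuation_le_one_of_isIntegral {V : ValuationSubring F}
    (hV : ∀ a : A, V.valuation (algebraMap A F a) ≤ 1) {z : F} (hz : IsIntegral A z) :
    V.valuation z ≤ 1 := by
  let f : A →+* V := (algebraMap A F).codRestrict V.toSubring
    fun a => (V.valuation_le_one_iff _).1 (hV a)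
  let := f.toAlgebra
  have : IsScalarTower A V F := .of_algebraMap_eq fun _ => rfl
  obtain ⟨y, rfl⟩ := IsIntegrallyClosed.algebraMap_eq_of_integral (hz.tower_top (A := V))
  exact V.valuation_le_one y

/-- The integral closure is the intersection of the valuation rings containing A. -/
lemma isIntegral_of_forall_valuation_le_one {z : F}
    (h : ∀ V : ValuationSubring F, (∀ a : A, V.valuation (algebraMap A F a) ≤ 1) →
      V.valuation z ≤ 1) : IsIntegral A z := by
  by_contra hz
  let S := integralClosure A F
  have : IsIntegrallyClosedIn S.toSubring F := inferInstanceAs (IsIntegrallyClosedIn S F)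
  obtain ⟨V, hV, hVz⟩ := Subring.exists_le_valuationSubring_of_isIntegrallyClosedIn
    (R := S.toSubring) (x := z) hz
  exact hVz ((V.valuation_le_one_iff z).1 (h V fun a =>
    (V.valuation_le_one_iff _).2 (hV (S.algebraMap_mem a))))

/-- A valuation ring dominating a maximal ideal of a Dedekind domain consists of the fractions
whose denominator is not in the ideal. -/
lemma Dominates.exists_mul_eq [IsDedekindDomain A] [IsFractionRing A F] {V : ValuationSubring F}
    {p : Ideal A} (hp : p.IsMaximal) (h : V.Dominates p) {z : F} (hz : V.valuation z ≤ 1) :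
    ∃ a, ∃ b ∉ p, z * algebraMap A F b = algebraMap A F a := by
  have hinj := IsFractionRing.injective A F
  obtain ⟨a, b, hb, rfl⟩ := IsFractionRing.div_surjective (A := A) z
  have hb0 := nonZeroDivisors.ne_zero hb
  have hb0' : algebraMap A F b ≠ 0 := fun h => hb0 (hinj (h.trans (map_zero _).symm))
  -- In a Dedekind domain containment is division, so (a, b) J = (b). An element j of J outside p
  -- would be the wanted denominator, because a j = b u means z j = u.
  obtain ⟨J, hJ⟩ := Ideal.dvd_iff_le.2
    ((Ideal.span_singleton_le_iff_mem (Ideal.span {a, b})).2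
      (Ideal.subset_span (Set.mem_insert_of_mem _ rfl)))
  have hmul {x : A} (hx : x ∈ ({a, b} : Set A)) {j : A} (hj : j ∈ J) : ∃ u, x * j = b * u :=
    Ideal.mem_span_singleton.1 (hJ ▸ Ideal.mul_mem_mul (Ideal.subset_span hx) hj)
  by_contra! H
  have hmem {j : A} (hj : j ∈ J) : j ∈ p := by
    by_contra hjp
    obtain ⟨u, hu⟩ := hmul (Set.mem_insert a {b}) hj
    refine H u j hjp ?_
    rw [div_mul_eq_mul_div, div_eq_iff hb0', ← map_mul, ← map_mul, hu, mul_comm]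
  -- Now J ⊆ p, so z j has valuation below 1 and its numerator u lies in p. Hence (b) = (a, b) J ⊆ b
  -- p, which forces 1 ∈ p.
  have hmem' {j : A} (hj : j ∈ J) : ∃ u ∈ p, a * j = b * u := by
    obtain ⟨u, hu⟩ := hmul (Set.mem_insert a {b}) hj
    refine ⟨u, (h.lt_one_iff hp).1 ?_, hu⟩
    have hu' : algebraMap A F u = algebraMap A F a / algebraMap A F b * algebraMap A F j := by
      rw [div_mul_eq_mul_div, eq_div_iff hb0', ← map_mul, ← map_mul, hu, mul_comm]
    rw [hu', map_mul]
    exact mul_lt_one_of_nonneg_of_lt_one_right hz zero_le (h.2 j (hmem hj))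
  have hb1 : b ∈ Ideal.span {a, b} * J := hJ ▸ Ideal.mem_span_singleton_self b
  obtain ⟨u, hu, hu'⟩ : ∃ u ∈ p, b * u = b := by
    rw [Ideal.span_insert, Ideal.sup_mul] at hb1
    obtain ⟨s, hs, t, ht, hst⟩ := Submodule.mem_sup.1 hb1
    obtain ⟨j, hj, rfl⟩ := Ideal.mem_span_singleton_mul.1 hs
    obtain ⟨k, hk, rfl⟩ := Ideal.mem_span_singleton_mul.1 ht
    obtain ⟨u, hu, hju⟩ := hmem' hj
    exact ⟨u + k, p.add_mem hu (hmem hk), by rw [mul_add, ← hju, hst]⟩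
  rw [mul_eq_left₀ hb0] at hu'
  exact hp.ne_top ((Ideal.eq_top_iff_one _).2 (hu' ▸ hu))

lemma Dominates.map {S : Type*} [CommRing S] [Algebra A S] [Algebra S F]
    [IsScalarTower A S F] {V : ValuationSubring F} {p : Ideal A}
    (h : V.Dominates p) (hS : ∀ s : S, V.valuation (algebraMap S F s) ≤ 1) :
    V.Dominates (p.map (algebraMap A S)) := by
  refine ⟨hS, fun s hs => ?_⟩
  induction hs using Submodule.span_induction with
  | mem x hx =>
    obtain ⟨a, ha, rfl⟩ := hx
    rw [← IsScalarTower.algebraMap_apply]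
    exact h.2 a ha
  | zero => simp
  | add x y _ _ hx hy => rw [map_add]; exact V.valuation.map_add_lt hx hy
  | smul a x _ hx =>
    rw [smul_eq_mul, map_mul, map_mul]
    exact mul_lt_one_of_nonneg_of_lt_one_right (hS a) zero_le hx

end ValuationSubring

/-! ### Pushforward of ideals by the relative norm. -/

section Norm

variable {R R' S F : Type*} [CommRing R] [CommRing R'] [CommRing S] [Field F]
  [Algebra R S] [Algebra R' S]
  [Algebra R F] [Algebra R' F] [Algebra S F] [IsScalarTower R S F] [IsScalarTower R' S F]
  [IsDedekindDomain R] [IsFractionRing R F] [FaithfulSMul S F]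

/-- Write s = a / b with b outside p and c b + d = 1 with d in p; then s - a c = s d. So passing
from R to S does not enlarge the residue ring at p. -/
lemma ValuationSubring.Dominates.exists_sub_mem_map {V : ValuationSubring F} {p : Ideal R}
    (hp : p.IsMaximal) (h : V.Dominates p) (hS : ∀ s : S, V.valuation (algebraMap S F s) ≤ 1)
    (s : S) : ∃ r, s - algebraMap R S r ∈ p.map (algebraMap R S) := by
  obtain ⟨a, b, hb, hab⟩ := h.exists_mul_eq hp (hS s)
  obtain ⟨c, d, hd, hcd⟩ := hp.exists_inv hb
  have hab' : s * algebraMap R S b = algebraMap R S a := by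
    apply FaithfulSMul.algebraMap_injective S F
    rwa [map_mul, ← IsScalarTower.algebraMap_apply, ← IsScalarTower.algebraMap_apply]
  refine ⟨a * c, ?_⟩
  have : s - algebraMap R S (a * c) = s * algebraMap R S d := by
    have h1 := congr_arg (algebraMap R S) hcd
    simp only [map_add, map_mul, map_one] at h1 ⊢
    linear_combination (-s) * h1 + algebraMap R S c * hab'
  exact this ▸ Ideal.mul_mem_left _ _ (Ideal.mem_map_of_mem _ hd)

variable [IsDedekindDomain R'] [IsDedekindDomain S]
  [Module.Finite R' S] [Module.IsTorsionFree R' S] [CharZero R']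

/-- The relative norm along an extension of maximal ideals with trivial residue field
extension. -/
lemma ValuationSubring.Dominates.relNorm_map_eq (K : Type*) [Field K]
    [IsAlgClosed K] [Algebra K R] [Algebra K R'] [Algebra K S] [IsScalarTower K R S]
    [IsScalarTower K R' S] [Algebra.FiniteType K R] {V : ValuationSubring F} {p : Ideal R}
    {p' : Ideal R'} (hp : p.IsMaximal) (hp' : p'.IsMaximal) (h : V.Dominates p)
    (h' : V.Dominates p') (hS : ∀ s : S, V.valuation (algebraMap S F s) ≤ 1) :
    Ideal.relNorm R' (p.map (algebraMap R S)) = p' := by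
  have hq := h.map hS
  set q := p.map (algebraMap R S)
  -- Each class modulo q comes from R, hence from K. So q is maximal, with no ramification or
  -- residue extension over p.
  have hsurj : Function.Surjective (algebraMap K (S ⧸ q)) := by
    intro z
    obtain ⟨s, rfl⟩ := Ideal.Quotient.mk_surjective z
    obtain ⟨r, hr⟩ := h.exists_sub_mem_map hp hS s
    obtain ⟨k, hk⟩ := (hp.bijective_algebraMap_quotient (K := K)).2 (Ideal.Quotient.mk p r)
    refine ⟨k, ?_⟩
    have hk' : algebraMap K R k - r ∈ p := (Ideal.Quotient.mk_eq_mk_iff_sub_mem _ _).1 hk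
    refine (Ideal.Quotient.mk_eq_mk_iff_sub_mem (algebraMap K S k) s).2 ?_
    have := q.sub_mem (Ideal.mem_map_of_mem (algebraMap R S) hk') hr
    rwa [map_sub, ← IsScalarTower.algebraMap_apply, sub_sub_sub_cancel_right] at this
  have : Nontrivial (S ⧸ q) := Ideal.Quotient.nontrivial_iff.2 hq.ne_top
  have hqm : q.IsMaximal := Ideal.Quotient.maximal_of_isField _ <|
    (RingEquiv.ofBijective _ ⟨(algebraMap K (S ⧸ q)).injective, hsurj⟩).symm.toMulEquiv.isField
      (Field.toIsField K)
  have hover : q.LiesOver p' := by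
    refine ⟨hp'.eq_of_le (Ideal.comap_ne_top _ hqm.ne_top) fun a ha => ?_⟩
    refine (hq.lt_one_iff hqm).1 ?_
    rw [← IsScalarTower.algebraMap_apply]
    exact h'.2 a ha
  have hsurj' : Function.Surjective (algebraMap (R' ⧸ p') (S ⧸ q)) := by
    intro z
    obtain ⟨k, rfl⟩ := hsurj z
    refine ⟨Ideal.Quotient.mk p' (algebraMap K R' k), ?_⟩
    rw [Ideal.Quotient.algebraMap_mk_of_liesOver, ← IsScalarTower.algebraMap_apply]
    rfl
  rw [Ideal.relNorm_eq_pow_of_isMaximal q p', Ideal.inertiaDeg_eq_of_isMaximal p' q]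
  let := Ideal.Quotient.field p'
  have h1 : Module.finrank (R' ⧸ p') (S ⧸ q) = 1 := by
    rw [← (LinearEquiv.ofBijective (Algebra.linearMap (R' ⧸ p') (S ⧸ q))
      ⟨(algebraMap (R' ⧸ p') (S ⧸ q)).injective, hsurj'⟩).finrank_eq, Module.finrank_self]
  rw [h1, pow_one]

end Norm

section IdealNorm

attribute [local instance] FractionRing.liftAlgebra

/-- The pushforward of ideals along a morphism of affine curves inducing a finite extension of
function fields. -/
theorem exists_idealNorm (K : Type*) {R R' F : Type*} [Field K] [IsAlgClosed K] [CharZero K]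
    [CommRing R] [CommRing R'] [Field F] [Algebra K R] [Algebra K R'] [Algebra K F] [Algebra R F]
    [Algebra R' F] [IsScalarTower K R F] [IsScalarTower K R' F] [IsDedekindDomain R]
    [IsDedekindDomain R'] [Algebra.FiniteType K R] [IsFractionRing R F] [FaithfulSMul R' F]
    (H : ∀ V : ValuationSubring F, (∀ a, V.valuation (algebraMap R' F a) ≤ 1) →
      ∀ a, V.valuation (algebraMap R F a) ≤ 1) :
    ∃ N : Ideal R →* Ideal R',
      (∀ a ≠ 0, ∃ b ≠ 0, N (Ideal.span {a}) = Ideal.span {b}) ∧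
      (∀ (p : Ideal R) (p' : Ideal R'), p.IsMaximal → p'.IsMaximal →
        (∀ V : ValuationSubring F, V.Dominates p → V.Dominates p') → N p = p') ∧
      ∀ p : Ideal R, p.IsMaximal →
        (∀ V : ValuationSubring F, V.Dominates p → ∃ a, ¬ V.valuation (algebraMap R' F a) ≤ 1) →
        N p = ⊤ := by
  have hint (a : R) : IsIntegral R' (algebraMap R F a) :=
    ValuationSubring.isIntegral_of_forall_valuation_le_one fun V hV => H V hV a
  have : CharZero R' := charZero_of_injective_algebraMap (R := K)
    (FaithfulSMul.algebraMap_injective K R')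
  have : CharZero (FractionRing R') := charZero_of_injective_algebraMap (R := R')
    (IsFractionRing.injective R' (FractionRing R'))
  -- F is finite over Frac R': it is essentially of finite type, and its elements are quotients of
  -- elements integral over R'.
  have : Algebra.EssFiniteType R F := .of_isLocalization _ (nonZeroDivisors R)
  have : Algebra.EssFiniteType K F := .comp K R F
  have : Algebra.EssFiniteType (FractionRing R') F := .of_comp K _ _
  have : Algebra.IsAlgebraic (FractionRing R') F := by
    refine ⟨fun z => ?_⟩
    obtain ⟨a, b, -, rfl⟩ := IsFractionRing.div_surjective (A := R) z
    rw [div_eq_mul_inv]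
    exact (((hint a).tower_top (A := FractionRing R')).isAlgebraic).mul
      ((hint b).tower_top (A := FractionRing R')).isAlgebraic.inv
  have : FiniteDimensional (FractionRing R') F := Algebra.finite_of_essFiniteType_of_isAlgebraic
  -- Geometrically S is the ring of the preimage of affine E'. The hypothesis `H` places R inside
  -- it.
  let S := integralClosure R' F
  have : Module.Finite R' S := IsIntegralClosure.finite R' (FractionRing R') F S
  let e : R →+* S := (algebraMap R F).codRestrict S.toSubring hint
  let := e.toAlgebra
  have : IsScalarTower R S F := .of_algebraMap_eq fun _ => rfl
  have : IsScalarTower K R S := .of_algebraMap_eq fun k => Subtype.ext <|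
    IsScalarTower.algebraMap_apply K R F k
  have hS (V : ValuationSubring F) (hV : ∀ a, V.valuation (algebraMap R' F a) ≤ 1) (s : S) :
      V.valuation (algebraMap S F s) ≤ 1 :=
    ValuationSubring.valuation_le_one_of_isIntegral hV s.2
  refine ⟨(Ideal.relNorm R' (S := S) : Ideal S →* Ideal R').comp (Ideal.mapHom (algebraMap R S)),
    fun a ha => ?_, fun p p' hp hp' h => ?_, fun p hp h => ?_⟩
  · refine ⟨Algebra.intNorm R' S (algebraMap R S a), ?_, ?_⟩
    · rw [Algebra.intNorm_ne_zero]
      exact fun h => ha (IsFractionRing.injective R F (by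
        rw [IsScalarTower.algebraMap_apply R S F, h, map_zero, map_zero]))
    · change Ideal.relNorm R' (Ideal.map _ _) = _
      rw [Ideal.map_span, Set.image_singleton, Ideal.relNorm_singleton]
  · obtain ⟨V, hV⟩ := ValuationSubring.exists_dominates (F := F) hp.ne_top
    exact hV.relNorm_map_eq K hp hp' (h V hV) (hS V (h V hV).1)
  · change Ideal.relNorm R' (Ideal.map _ _) = _
    -- A point sent to infinity disappears from Spec S: a valuation ring dominating p S would
    -- contain R'.
    suffices p.map (algebraMap R S) = ⊤ by rw [this, Ideal.relNorm_top]
    by_contra hne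
    obtain ⟨V, hV⟩ := ValuationSubring.exists_dominates (F := F) hne
    obtain ⟨a, ha⟩ := h V ⟨fun a => hV.1 (algebraMap R S a),
      fun a ha => hV.2 _ (Ideal.mem_map_of_mem _ ha)⟩
    exact ha (hV.1 (algebraMap R' S a))

end IdealNorm
end

/-! ### Reduction of projective points modulo a valuation ring. -/

open scoped WeierstrassCurve.Affine Polynomial.Bivariate

noncomputable section

open Polynomial

lemma MvPolynomial.IsHomogeneous.aeval_smul_eq {σ R A : Type*} [CommRing R] [CommRing A]
    [Algebra R A] {p : MvPolynomial σ R} {d : ℕ} (hp : p.IsHomogeneous d) (t : A) (g : σ → A) :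
    MvPolynomial.aeval (t • g) p = t ^ d • MvPolynomial.aeval g p := by
  rw [MvPolynomial.aeval_def, MvPolynomial.aeval_def, MvPolynomial.eval₂_eq, MvPolynomial.eval₂_eq,
    Finset.smul_sum]
  refine Finset.sum_congr rfl fun m hm => ?_
  have hd : ∑ i ∈ m.support, m i = d := by
    rw [← hp (MvPolynomial.mem_support_iff.1 hm), Finsupp.weight_apply]
    simp [Finsupp.sum]
  simp only [Pi.smul_apply, smul_eq_mul, mul_pow, Finset.prod_mul_distrib,
    Finset.prod_pow_eq_pow_sum, hd]
  ring

namespace ValuationSubring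

variable {K F : Type*} [Field K] [Field F] [Algebra K F] {V : ValuationSubring F}

lemma valuation_mul_lt_one {a b : F} (ha : V.valuation a ≤ 1) (hb : V.valuation b < 1) :
    V.valuation (a * b) < 1 := by
  rw [map_mul]
  exact mul_lt_one_of_nonneg_of_lt_one_right ha zero_le hb

lemma valuation_le_one_of_sub_lt_one {a b : F} (hb : V.valuation b ≤ 1)
    (h : V.valuation (a - b) < 1) : V.valuation a ≤ 1 := by
  simpa using V.valuation.map_add_le h.le hb

/-- Two algebra homomorphisms which are congruent modulo the maximal ideal on generators are
congruent everywhere. -/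
lemma valuation_sub_lt_one_of_adjoin_eq_top (hK : ∀ c : K, V.valuation (algebraMap K F c) ≤ 1)
    {A : Type*} [CommRing A] [Algebra K A] (f : A →ₐ[K] F) (g : A →ₐ[K] K) {s : Set A}
    (hs : Algebra.adjoin K s = ⊤)
    (h : ∀ a ∈ s, V.valuation (f a - algebraMap K F (g a)) < 1) (a : A) :
    V.valuation (f a - algebraMap K F (g a)) < 1 := by
  have ha : a ∈ Algebra.adjoin K s := hs ▸ trivial
  induction ha using Algebra.adjoin_induction with
  | mem x hx => exact h x hx
  | algebraMap r => simp
  | add x y _ _ hx hy =>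
    rw [map_add, map_add, map_add, add_sub_add_comm]
    exact V.valuation.map_add_lt hx hy
  | mul x y _ _ hx hy =>
    have : f (x * y) - algebraMap K F (g (x * y)) = f x * (f y - algebraMap K F (g y)) +
        algebraMap K F (g y) * (f x - algebraMap K F (g x)) := by
      simp only [map_mul]; ring
    rw [this]
    exact V.valuation.map_add_lt
      (valuation_mul_lt_one (valuation_le_one_of_sub_lt_one (hK _) hx) hy)
      (valuation_mul_lt_one (hK _) hx)

/-- The point of the projective plane over `F` with coordinates `g` reduces modulo the maximal
ideal of `V` to the point with coordinates `h`. -/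
def IsCenter (V : ValuationSubring F) (g : Fin 3 → F) (h : Fin 3 → K) : Prop :=
  ∃ t : F, ∀ i, V.valuation (t * g i - algebraMap K F (h i)) < 1

/-- Polynomials over K preserve congruences modulo the maximal ideal, and homogeneity pulls the
scaling factor t out as t ^ d. Thus reduction commutes with any chart that does not vanish at the
reduced point. -/
lemma IsCenter.map (hK : ∀ c : K, V.valuation (algebraMap K F c) ≤ 1) {g g' : Fin 3 → F}
    {h h' : Fin 3 → K} (hg : V.IsCenter g h) {d : ℕ} {G : Fin 3 → MvPolynomial (Fin 3) K}
    (hG : ∀ i, (G i).IsHomogeneous d) {u : F}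
    (hu : ∀ i, MvPolynomial.aeval g (G i) = u * g' i) {c : K} (hc : c ≠ 0)
    (hc' : ∀ i, MvPolynomial.aeval h (G i) = c * h' i) : V.IsCenter g' h' := by
  obtain ⟨t, ht⟩ := hg
  refine ⟨algebraMap K F c⁻¹ * (t ^ d * u), fun i => ?_⟩
  have h1 := valuation_sub_lt_one_of_adjoin_eq_top hK (MvPolynomial.aeval (t • g))
    (MvPolynomial.aeval h) MvPolynomial.adjoin_range_X (by
      rintro _ ⟨j, rfl⟩
      simpa using ht j) (G i)
  rw [(hG i).aeval_smul_eq, smul_eq_mul, hu, hc'] at h1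
  have h2 : algebraMap K F c⁻¹ * (t ^ d * u) * g' i - algebraMap K F (h' i) =
      algebraMap K F c⁻¹ * (t ^ d * (u * g' i) - algebraMap K F (c * h' i)) := by
    have : algebraMap K F c⁻¹ * algebraMap K F c = 1 := by
      rw [← map_mul, inv_mul_cancel₀ hc, map_one]
    rw [map_mul]
    linear_combination algebraMap K F (h' i) * this
  rw [h2]
  exact valuation_mul_lt_one (hK _) h1

/-- The scaling factor t satisfies t ≡ 0 and t y ≡ 1. -/
lemma IsCenter.not_valuation_le_one {x y : F} (h : V.IsCenter ![x, y, 1] ![(0 : K), 1, 0]) :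
    ¬ V.valuation y ≤ 1 := by
  obtain ⟨t, ht⟩ := h
  have h1 := ht 1
  have h2 := ht 2
  simp only [Fin.isValue, Matrix.cons_val, map_one, map_zero, mul_one, sub_zero] at h1 h2
  intro hy
  have h3 := V.valuation.map_sub_lt (valuation_mul_lt_one hy h2) h1
  rw [mul_comm y, sub_sub_cancel, map_one] at h3
  exact h3.ne rfl

lemma IsCenter.valuation_sub_lt_one (hK : ∀ c : K, V.valuation (algebraMap K F c) ≤ 1) {x y : F}
    {a b : K} (h : V.IsCenter ![x, y, 1] ![a, b, 1]) :
    V.valuation (x - algebraMap K F a) < 1 ∧ V.valuation (y - algebraMap K F b) < 1 := by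
  obtain ⟨t, ht⟩ := h
  have h0 := ht 0
  have h1 := ht 1
  have h2 := ht 2
  simp only [Fin.isValue, Matrix.cons_val, map_one, mul_one] at h0 h1 h2
  have ht1 : V.valuation t = 1 := by
    have := V.valuation.map_one_add_of_lt h2
    rwa [add_sub_cancel] at this
  have key {z : F} {c : K} (hz : V.valuation (t * z - algebraMap K F c) < 1) :
      V.valuation (z - algebraMap K F c) < 1 := by
    have h3 := V.valuation.map_sub_lt hz (valuation_mul_lt_one (hK c) h2)
    have h4 : t * z - algebraMap K F c - algebraMap K F c * (t - 1) =
      t * (z - algebraMap K F c) := by ring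
    rwa [h4, map_mul, ht1, one_mul] at h3
  exact ⟨key h0, key h1⟩

lemma IsCenter.of_valuation_sub_lt_one {x y : F} {a b : K}
    (hx : V.valuation (x - algebraMap K F a) < 1) (hy : V.valuation (y - algebraMap K F b) < 1) :
    V.IsCenter ![x, y, 1] ![a, b, 1] := by
  refine ⟨1, fun i => ?_⟩
  fin_cases i
  · simpa using hx
  · simpa using hy
  · simp

/-- A valuation ring in which the coordinates of a point of a Weierstrass curve do not both lie
is centered at the point at infinity. -/
lemma isCenter_zero {x y : F} {a₁ a₂ a₃ a₄ a₆ : F} (h₁ : a₁ ∈ V) (h₂ : a₂ ∈ V) (h₃ : a₃ ∈ V)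
    (h₄ : a₄ ∈ V) (h₆ : a₆ ∈ V)
    (h : y ^ 2 + a₁ * x * y + a₃ * y = x ^ 3 + a₂ * x ^ 2 + a₄ * x + a₆)
    (hxy : ¬ (x ∈ V ∧ y ∈ V)) : V.IsCenter ![x, y, 1] ![(0 : K), 1, 0] := by
  have inv_lt {z : F} (hz : z ∉ V) : z ≠ 0 ∧ z⁻¹ ∈ V ∧ V.valuation z⁻¹ < 1 := by
    have hz0 : z ≠ 0 := by rintro rfl; exact hz V.zero_mem
    exact ⟨hz0, (V.mem_or_inv_mem z).resolve_left hz,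
      V.mem_nonunits_iff.1 (V.inv_mem_nonunits_iff.2 (.inr hz))⟩
  have absurd_of {s X : F} (hs : V.valuation s < 1) (hX : X ∈ V) (h1 : X * s = 1) : False := by
    have := valuation_mul_lt_one ((V.valuation_le_one_iff X).2 hX) hs
    rw [h1, map_one] at this
    exact this.ne rfl
  suffices y ≠ 0 ∧ V.valuation (y⁻¹ * x) < 1 ∧ V.valuation y⁻¹ < 1 by
    refine ⟨y⁻¹, fun i => ?_⟩
    fin_cases i
    · simpa using this.2.1
    · simp [this.1]
    · simpa using this.2.2
  by_cases hx : x ∈ V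
  · have hy : y ∉ V := fun hy => hxy ⟨hx, hy⟩
    obtain ⟨hy0, hyV, hy1⟩ := inv_lt hy
    -- This element is y itself, by the equation divided by y; it would lie in V.
    refine (absurd_of hy1 (X := (x ^ 3 + a₂ * x ^ 2 + a₄ * x + a₆) * y⁻¹ - a₁ * x - a₃) ?_ ?_).elim
    · exact V.toSubring.sub_mem (V.toSubring.sub_mem (V.mul_mem _ _ (V.add_mem _ _ (V.add_mem _ _
        (V.add_mem _ _ (pow_mem hx 3) (V.mul_mem _ _ h₂ (pow_mem hx 2))) (V.mul_mem _ _ h₄ hx)) h₆)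
        hyV) (V.mul_mem _ _ h₁ hx)) h₃
    · rw [← h]
      field_simp
      ring
  · obtain ⟨hx0, hxV, hx1⟩ := inv_lt hx
    have hz : y * x⁻¹ ∉ V := by
      intro hz
      -- This element is x itself, by the equation divided by x²; it would lie in V.
      refine absurd_of hx1 (X := (y * x⁻¹) ^ 2 + a₁ * (y * x⁻¹) + a₃ * (y * x⁻¹) * x⁻¹ - a₂ -
        a₄ * x⁻¹ - a₆ * x⁻¹ ^ 2) ?_ ?_
      · exact V.toSubring.sub_mem (V.toSubring.sub_mem (V.toSubring.sub_mem (V.add_mem _ _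
          (V.add_mem _ _ (pow_mem hz 2) (V.mul_mem _ _ h₁ hz))
          (V.mul_mem _ _ (V.mul_mem _ _ h₃ hz) hxV)) h₂) (V.mul_mem _ _ h₄ hxV))
          (V.mul_mem _ _ h₆ (pow_mem hxV 2))
      · field_simp
        linear_combination h
    obtain ⟨hz0, -, hz1⟩ := inv_lt hz
    have hy0 : y ≠ 0 := left_ne_zero_of_mul hz0
    rw [mul_inv, inv_inv] at hz1
    refine ⟨hy0, hz1, ?_⟩
    have : y⁻¹ = x⁻¹ * (y⁻¹ * x) := by field_simp
    rw [this]
    exact valuation_mul_lt_one hx1.le hz1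

end ValuationSubring
end

/-! ### Morphisms of curves: generic point and comorphism. -/

open scoped WeierstrassCurve.Affine Polynomial.Bivariate

noncomputable section

open Polynomial

namespace WeierstrassCurve.Affine

variable {K : Type*} [Field K] {W W' : WeierstrassCurve.Affine K}

/-- Homogeneous coordinates of a point. -/
def Point.projCoords : W.Point → Fin 3 → K
  | .zero => ![0, 1, 0]
  | .some x y _ => ![x, y, 1]

/-- The tuple `G` of forms of degree `d` describes the map `φ` wherever it does not vanish. -/
def IsChart (φ : W.Point → W'.Point) (d : ℕ) (G : Fin 3 → MvPolynomial (Fin 3) K) : Prop :=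
  (∀ i, (G i).IsHomogeneous d) ∧
    ∀ Q : W.Point, (∃ i, MvPolynomial.aeval Q.projCoords (G i) ≠ 0) →
      ∃ c : K, c ≠ 0 ∧ ∀ i, MvPolynomial.aeval Q.projCoords (G i) = c * (φ Q).projCoords i

/-- The map `φ` is a morphism of projective curves. -/
def IsRegularMap (φ : W.Point → W'.Point) : Prop :=
  ∀ P : W.Point, ∃ d G, IsChart φ d G ∧ ∃ i, MvPolynomial.aeval P.projCoords (G i) ≠ 0

namespace CoordinateRing

variable (W) in
/-- Homogeneous coordinates of the generic point, in the coordinate ring. -/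
def genCoords : Fin 3 → W.CoordinateRing := ![xGen W, yGen W, 1]

lemma evalAt_aeval_genCoords {x y : K} (h : W.Equation x y) (p : MvPolynomial (Fin 3) K) :
    evalAt h (MvPolynomial.aeval (genCoords W) p) = MvPolynomial.aeval ![x, y, 1] p := by
  rw [← AlgHom.comp_apply, MvPolynomial.comp_aeval]
  congr 2
  ext i
  fin_cases i <;> simp [genCoords, evalAt]

/-- A function vanishing at all points is zero. -/
lemma eq_zero_of_forall_evalAt [IsAlgClosed K] {r : W.CoordinateRing}
    (hr : ∀ x y, ∀ h : W.Equation x y, evalAt h r = 0) : r = 0 := by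
  have : IsJacobsonRing W.CoordinateRing := isJacobsonRing_of_finiteType (A := K)
  have h0 : (⊥ : Ideal W.CoordinateRing).jacobson = ⊥ :=
    IsJacobsonRing.out (inferInstance : IsJacobsonRing W.CoordinateRing)
      Ideal.isPrime_bot.isRadical
  rw [← Ideal.mem_bot, ← h0, Ideal.jacobson, Ideal.mem_sInf]
  rintro M ⟨-, hM⟩
  obtain ⟨x, y, h, rfl⟩ := exists_eq_XYIdeal hM
  exact (mem_XYIdeal_iff h).2 (hr x y h)

/-- The kernel is prime in a ring of dimension at most one: it is zero, or maximal with residue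
field K. -/
lemma lift_injective_or [IsAlgClosed K] [W.IsElliptic] {L : Type*} [Field L] [Algebra K L]
    (f : W.CoordinateRing →ₐ[K] L) :
    Function.Injective f ∨ ∀ r, ∃ c, f r = algebraMap K L c := by
  by_cases hf : RingHom.ker f = ⊥
  · exact .inl ((RingHom.injective_iff_ker_eq_bot f).2 hf)
  · have hM : (RingHom.ker f).IsMaximal := (RingHom.ker_isPrime f).isMaximal hf
    refine .inr fun r => ?_
    obtain ⟨c, hc⟩ := (hM.bijective_algebraMap_quotient (K := K)).2 (Ideal.Quotient.mk _ r)
    refine ⟨c, ?_⟩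
    have : algebraMap K _ c - r ∈ RingHom.ker f := (Ideal.Quotient.mk_eq_mk_iff_sub_mem _ _).1 hc
    rw [RingHom.mem_ker, map_sub, AlgHom.commutes, sub_eq_zero] at this
    exact this.symm

lemma not_isIntegral_xGen [IsAlgClosed K] : ¬ _root_.IsIntegral K (xGen W) := by
  intro h
  have : Algebra.IsIntegral K (Algebra.adjoin K {xGen W}) := Algebra.IsIntegral.adjoin (by simpa)
  obtain ⟨c, hc⟩ := (IsAlgClosed.algebraMap_bijective_of_isIntegral (k := K)
    (K := Algebra.adjoin K {xGen W})).2 ⟨xGen W, Algebra.self_mem_adjoin_singleton K _⟩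
  refine XClass_ne_zero (W' := W) c ?_
  rw [XClass_eq, sub_eq_zero]
  exact (congr_arg Subtype.val hc).symm

end CoordinateRing

open CoordinateRing

/-- At each point both charts are proportional to the coordinates of the image, or one vanishes; so
the 2 × 2 minors vanish everywhere. This makes the generic image independent of the chart. -/
lemma IsChart.mul_eq_mul [IsAlgClosed K] [W.IsElliptic] {φ : W.Point → W'.Point} {d e : ℕ}
    {G G' : Fin 3 → MvPolynomial (Fin 3) K} (hG : IsChart φ d G) (hG' : IsChart φ e G')
    (i j : Fin 3) :
    MvPolynomial.aeval (genCoords W) (G i) * MvPolynomial.aeval (genCoords W) (G' j) =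
      MvPolynomial.aeval (genCoords W) (G j) * MvPolynomial.aeval (genCoords W) (G' i) := by
  rw [← sub_eq_zero]
  refine eq_zero_of_forall_evalAt fun x y h => ?_
  simp only [map_sub, map_mul, evalAt_aeval_genCoords]
  have h1 := hG.2 (.some x y ((W.equation_iff_nonsingular).1 h))
  have h2 := hG'.2 (.some x y ((W.equation_iff_nonsingular).1 h))
  simp only [Point.projCoords] at h1 h2
  by_cases h3 : ∃ i, MvPolynomial.aeval ![x, y, 1] (G i) ≠ 0
  · by_cases h4 : ∃ i, MvPolynomial.aeval ![x, y, 1] (G' i) ≠ 0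
    · obtain ⟨c, -, hc⟩ := h1 h3
      obtain ⟨c', -, hc'⟩ := h2 h4
      rw [hc, hc, hc', hc']
      ring
    · push Not at h4
      simp [h4]
  · push Not at h3
    simp [h3]

lemma IsChart.equation [IsAlgClosed K] [W.IsElliptic] {φ : W.Point → W'.Point} {d : ℕ}
    {G : Fin 3 → MvPolynomial (Fin 3) K} (hG : IsChart φ d G) {g : Fin 3 → W.CoordinateRing}
    (hg : ∀ i, g i = MvPolynomial.aeval (genCoords W) (G i)) :
    g 1 ^ 2 * g 2 + algebraMap K _ W'.a₁ * g 0 * g 1 * g 2 + algebraMap K _ W'.a₃ * g 1 * g 2 ^ 2 =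
      g 0 ^ 3 + algebraMap K _ W'.a₂ * g 0 ^ 2 * g 2 + algebraMap K _ W'.a₄ * g 0 * g 2 ^ 2 +
        algebraMap K _ W'.a₆ * g 2 ^ 3 := by
  rw [← sub_eq_zero]
  refine eq_zero_of_forall_evalAt fun x y h => ?_
  simp only [hg, map_sub, map_mul, map_add, map_pow, AlgHom.commutes, evalAt_aeval_genCoords,
    Algebra.algebraMap_self_apply]
  have h1 := hG.2 (.some x y ((W.equation_iff_nonsingular).1 h))
  simp only [Point.projCoords] at h1
  by_cases h3 : ∃ i, MvPolynomial.aeval ![x, y, 1] (G i) ≠ 0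
  · obtain ⟨c, -, hc⟩ := h1 h3
    rw [hc, hc, hc]
    rcases φ (.some x y _) with _ | ⟨a, b, hab⟩
    · simp
    · have := (W'.equation_iff a b).1 hab.1
      simp only [Matrix.cons_val]
      linear_combination c ^ 3 * this
  · push Not at h3
    simp [h3]

lemma aeval_algebraMap_gen (p : MvPolynomial (Fin 3) K) :
    MvPolynomial.aeval ![algebraMap _ W.FunctionField (xGen W), algebraMap _ _ (yGen W), 1] p =
      algebraMap W.CoordinateRing W.FunctionField (MvPolynomial.aeval (genCoords W) p) := by
  rw [← MvPolynomial.aeval_algebraMap_apply]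
  congr 2
  ext i
  fin_cases i <;> simp [genCoords]

/-- The image of the generic point under a morphism of curves. -/
lemma IsRegularMap.exists_generic [IsAlgClosed K] [W.IsElliptic] {φ : W.Point → W'.Point}
    (hφ : IsRegularMap φ) (h0 : φ 0 = 0) (hne : ∃ P, φ P ≠ 0) :
    ∃ x y : W.FunctionField,
      (y ^ 2 + algebraMap K _ W'.a₁ * x * y + algebraMap K _ W'.a₃ * y =
        x ^ 3 + algebraMap K _ W'.a₂ * x ^ 2 + algebraMap K _ W'.a₄ * x + algebraMap K _ W'.a₆) ∧
      ∀ d G, IsChart φ d G → ∃ u, ∀ i,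
        MvPolynomial.aeval ![algebraMap _ W.FunctionField (xGen W), algebraMap _ _ (yGen W), 1]
          (G i) = u * ![x, y, 1] i := by
  obtain ⟨P, hP⟩ := hne
  obtain ⟨d, G, hG, i, hi⟩ := hφ P
  set g : Fin 3 → W.CoordinateRing := fun i => MvPolynomial.aeval (genCoords W) (G i) with hg
  -- The chart is taken around a point with affine image, so its last form does not vanish there and
  -- division by `g 2` is allowed.
  have hg2 : g 2 ≠ 0 := by
    intro hg2
    rcases P with _ | ⟨x, y, h⟩
    · exact hP h0
    · obtain ⟨c, hc, hc'⟩ := hG.2 _ ⟨i, hi⟩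
      have h2 := hc' 2
      rcases hQ : φ (.some x y h) with _ | ⟨a, b, hab⟩
      · exact hP hQ
      · rw [hQ] at h2
        simp only [Point.projCoords, ← evalAt_aeval_genCoords (W.equation_iff_nonsingular.2 h), Matrix.cons_val, mul_one] at h2
        exact hc (h2.symm.trans ((congr_arg _ hg2).trans (map_zero _)))
  set ι := algebraMap W.CoordinateRing W.FunctionField
  have hι : Function.Injective ι := IsFractionRing.injective _ _
  have hι2 : ι (g 2) ≠ 0 := fun h => hg2 (hι (h.trans (map_zero ι).symm))
  refine ⟨ι (g 0) / ι (g 2), ι (g 1) / ι (g 2), ?_, fun e G' hG' => ?_⟩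
  · have := congr_arg ι (hG.equation (g := g) fun i => rfl)
    simp only [map_add, map_mul, map_pow, ι, ← IsScalarTower.algebraMap_apply K W.CoordinateRing
      W.FunctionField] at this
    field_simp
    linear_combination this
  · refine ⟨ι (MvPolynomial.aeval (genCoords W) (G' 2)), fun i => ?_⟩
    rw [aeval_algebraMap_gen]
    have h1 := congr_arg ι (hG'.mul_eq_mul hG i 2)
    rw [map_mul, map_mul] at h1
    change ι _ * ι (g 2) = _ * ι (g i) at h1
    have h2 : (![ι (g 0) / ι (g 2), ι (g 1) / ι (g 2), 1] : Fin 3 → W.FunctionField) i =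
        ι (g i) / ι (g 2) := by
      fin_cases i
      · rfl
      · rfl
      · exact (div_self hι2).symm
    rw [h2, mul_div_assoc', eq_div_iff hι2, h1]

/-- The comorphism of a morphism of curves, and its compatibility with places. -/
theorem IsRegularMap.exists_comorphism [IsAlgClosed K] [W.IsElliptic] [W'.IsElliptic]
    {φ : W.Point → W'.Point} (hφ : IsRegularMap φ) (h0 : φ 0 = 0) (hne : ∃ P, φ P ≠ 0) :
    ∃ f : W'.CoordinateRing →ₐ[K] W.FunctionField, Function.Injective f ∧
      (∀ V : ValuationSubring W.FunctionField, (∀ a, V.valuation (f a) ≤ 1) →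
        ∀ a, V.valuation (algebraMap W.CoordinateRing W.FunctionField a) ≤ 1) ∧
      ∀ (V : ValuationSubring W.FunctionField) (x y : K) (h : W.Nonsingular x y),
        V.Dominates (XYIdeal W x (C y)) →
        (φ (.some x y h) = 0 → ∃ a, ¬ V.valuation (f a) ≤ 1) ∧
        ∀ (a b : K) (h' : W'.Nonsingular a b), φ (.some x y h) = .some a b h' →
          (∀ r, V.valuation (f r) ≤ 1) ∧ ∀ r ∈ XYIdeal W' a (C b), V.valuation (f r) < 1 := by
  obtain ⟨x', y', heq, hgen⟩ := hφ.exists_generic h0 hne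
  set f := lift x' y' heq with hf
  have hfy : f (yGen W') = y' := lift_yGen heq
  have hfx : f (xGen W') = x' := lift_xGen heq
  have hcenter {V : ValuationSubring W.FunctionField}
      (hK : ∀ c : K, V.valuation (algebraMap K W.FunctionField c) ≤ 1) {P : W.Point}
      (hP : V.IsCenter ![algebraMap _ W.FunctionField (xGen W), algebraMap _ _ (yGen W), 1]
        P.projCoords) : V.IsCenter ![x', y', 1] (φ P).projCoords := by
    obtain ⟨d, G, hG, hi⟩ := hφ P
    obtain ⟨u, hu⟩ := hgen d G hG
    obtain ⟨c, hc, hc'⟩ := hG.2 P hi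
    exact hP.map hK hG.1 hu hc hc'
  have hreg (V : ValuationSubring W.FunctionField) (hV : ∀ a, V.valuation (f a) ≤ 1)
      (a : W.CoordinateRing) : V.valuation (algebraMap W.CoordinateRing W.FunctionField a) ≤ 1 := by
    have hK (c : K) : V.valuation (algebraMap K W.FunctionField c) ≤ 1 := by
      rw [← f.commutes]
      exact hV _
    have hK' (c : K) : algebraMap K W.FunctionField c ∈ V := (V.valuation_le_one_iff _).1 (hK c)
    by_cases hxy : algebraMap _ W.FunctionField (xGen W) ∈ V ∧
        algebraMap _ W.FunctionField (yGen W) ∈ V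
    · rw [V.valuation_le_one_iff]
      have ha : a ∈ Algebra.adjoin K {xGen W, yGen W} := adjoin_xGen_yGen W ▸ trivial
      induction ha using Algebra.adjoin_induction with
      | mem r hr =>
        rcases hr with rfl | rfl
        exacts [hxy.1, hxy.2]
      | algebraMap r =>
        rw [← IsScalarTower.algebraMap_apply]
        exact hK' r
      | add r s _ _ hr hs => rw [map_add]; exact V.add_mem _ _ hr hs
      | mul r s _ _ hr hs => rw [map_mul]; exact V.mul_mem _ _ hr hs
    -- Here V is centered at infinity on the source. As φ fixes infinity, the image is centered
    -- there too, so y' is not in V, contrary to `hV`.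
    · have h1 := congr_arg (algebraMap _ W.FunctionField) (xGen_yGen_equation W)
      simp only [map_add, map_mul, map_pow,
        ← IsScalarTower.algebraMap_apply K W.CoordinateRing W.FunctionField] at h1
      have h2 := hcenter hK (P := 0)
        (ValuationSubring.isCenter_zero (hK' _) (hK' _) (hK' _) (hK' _) (hK' _) h1 hxy)
      rw [h0] at h2
      exact (h2.not_valuation_le_one (hfy ▸ hV (yGen W'))).elim
  refine ⟨f, ?_, hreg, fun V x y h hV => ?_⟩
  -- If f took only constant values, `hreg` would put x in every valuation ring containing K, making
  -- x integral over K.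
  · refine (lift_injective_or f).resolve_right fun hconst => not_isIntegral_xGen (W := W) ?_
    refine (isIntegral_algebraMap_iff (IsFractionRing.injective W.CoordinateRing
      W.FunctionField)).1 ?_
    refine ValuationSubring.isIntegral_of_forall_valuation_le_one fun V hV => hreg V (fun a => ?_) _
    obtain ⟨c, hc⟩ := hconst a
    exact hc ▸ hV c
  · have hK (c : K) : V.valuation (algebraMap K W.FunctionField c) ≤ 1 := by
      rw [IsScalarTower.algebraMap_apply K W.CoordinateRing]
      exact hV.1 _
    have h1 : V.IsCenter ![algebraMap _ W.FunctionField (xGen W), algebraMap _ _ (yGen W), 1]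
        (Point.some x y h).projCoords := by
      refine .of_valuation_sub_lt_one ?_ ?_
      · rw [IsScalarTower.algebraMap_apply K W.CoordinateRing, ← map_sub, ← XClass_eq]
        exact hV.2 _ (Ideal.subset_span (Set.mem_insert _ _))
      · rw [IsScalarTower.algebraMap_apply K W.CoordinateRing, ← map_sub, ← YClass_eq]
        exact hV.2 _ (Ideal.subset_span (Set.mem_insert_of_mem _ rfl))
    have h2 := hcenter hK h1
    refine ⟨fun hP => ⟨yGen W', ?_⟩, fun a b hab hP => ?_⟩
    · rw [hP] at h2
      rw [hfy]
      exact h2.not_valuation_le_one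
    · rw [hP] at h2
      obtain ⟨hx, hy⟩ := h2.valuation_sub_lt_one hK
      have heq' := W'.equation_iff_nonsingular.2 hab
      have h3 := ValuationSubring.valuation_sub_lt_one_of_adjoin_eq_top hK f (evalAt heq')
        (adjoin_xGen_yGen W') (by
          rintro _ (rfl | rfl)
          · simpa [evalAt, hfx] using hx
          · simpa [evalAt, hfy] using hy)
      refine ⟨fun r => ValuationSubring.valuation_le_one_of_sub_lt_one (hK _) (h3 r),
        fun r hr => ?_⟩
      have h4 := h3 r
      rwa [(mem_XYIdeal_iff heq').1 hr, map_zero, sub_zero] at h4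

end WeierstrassCurve.Affine
end

/-! ### Additivity and surjectivity of morphisms preserving the origin. -/

open scoped WeierstrassCurve.Affine Polynomial.Bivariate

noncomputable section

open Polynomial

namespace WeierstrassCurve.Affine

open CoordinateRing

variable {K : Type*} [Field K] {W W' : WeierstrassCurve.Affine K}

/-- The ideal of a point, which is the unit ideal for the point at infinity. -/
def Point.ideal : W.Point → Ideal W.CoordinateRing
  | .zero => ⊤
  | .some x y _ => XYIdeal W x (C y)

lemma Point.ideal_zero : (0 : W.Point).ideal = 1 := Ideal.one_eq_top.symm

lemma Point.ideal_ne_bot (P : W.Point) : P.ideal ≠ ⊥ := by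
  rcases P with _ | ⟨x, y, h⟩
  · exact top_ne_bot
  · exact XYIdeal_ne_bot

variable [IsAlgClosed K] [W.IsElliptic] [W'.IsElliptic]

lemma Point.toClass_eq_mk0 [DecidableEq K] (P : W.Point) :
    toClass P = Additive.ofMul (ClassGroup.mk0
      ⟨P.ideal, mem_nonZeroDivisors_iff_ne_zero.2 P.ideal_ne_bot⟩) := by
  rcases P with _ | ⟨x, y, h⟩
  · refine toClass_zero.trans (ofMul_eq_zero.2 (ClassGroup.mk0_eq_one_iff _ |>.2 ?_)).symm
    exact (inferInstance : (⊤ : Ideal W.CoordinateRing).IsPrincipal)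
  · rw [toClass_some, ← ClassGroup.mk_mk0 W.FunctionField]
    refine congr_arg (ClassGroup.mk W.FunctionField) (Units.ext ?_)
    rfl

/-- Addition of points in terms of ideals. -/
lemma Point.add_eq_iff [DecidableEq K] {P Q T : W.Point} :
    P + Q = T ↔ ∃ a b : W.CoordinateRing, a ≠ 0 ∧ b ≠ 0 ∧
      Ideal.span {a} * (P.ideal * Q.ideal) = Ideal.span {b} * T.ideal := by
  rw [← toClass_injective.eq_iff, map_add, toClass_eq_mk0, toClass_eq_mk0, toClass_eq_mk0,
    ← ofMul_mul, ← map_mul, Additive.ofMul.injective.eq_iff, ClassGroup.mk0_eq_mk0_iff]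
  simp only [exists_prop]
  rfl

/-- A morphism of elliptic curves induces a pushforward of ideals. -/
theorem IsRegularMap.exists_pushforward [CharZero K] {φ : W.Point → W'.Point}
    (hφ : IsRegularMap φ) (h0 : φ 0 = 0) (hne : ∃ P, φ P ≠ 0) :
    ∃ N : Ideal W.CoordinateRing →* Ideal W'.CoordinateRing,
      (∀ a ≠ 0, ∃ b ≠ 0, N (Ideal.span {a}) = Ideal.span {b}) ∧ ∀ P, N P.ideal = (φ P).ideal := by
  obtain ⟨f, hf, hreg, hdom⟩ := hφ.exists_comorphism h0 hne
  let := f.toRingHom.toAlgebra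
  have : IsScalarTower K W'.CoordinateRing W.FunctionField :=
    .of_algebraMap_eq fun k => (f.commutes k).symm
  have : FaithfulSMul W'.CoordinateRing W.FunctionField :=
    (faithfulSMul_iff_algebraMap_injective _ _).2 hf
  obtain ⟨N, hN, hN1, hN2⟩ := exists_idealNorm K (R := W.CoordinateRing) (R' := W'.CoordinateRing)
    (F := W.FunctionField) hreg
  refine ⟨N, hN, fun P => ?_⟩
  rcases P with _ | ⟨x, y, h⟩
  · change N (0 : W.Point).ideal = (φ 0).ideal
    rw [h0, Point.ideal_zero, Point.ideal_zero, map_one]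
  · have hm := XYIdeal_isMaximal (W.equation_iff_nonsingular.2 h)
    rcases hP : φ (.some x y h) with _ | ⟨a, b, hab⟩
    · exact hN2 _ hm fun V hV => (hdom V x y h hV).1 hP
    · exact hN1 _ _ hm (XYIdeal_isMaximal (W'.equation_iff_nonsingular.2 hab)) fun V hV =>
        (hdom V x y h hV).2 a b hab hP

/-- A nonconstant morphism of elliptic curves preserving the origin is a homomorphism. -/
theorem IsRegularMap.map_add [CharZero K] [DecidableEq K] {φ : W.Point → W'.Point}
    (hφ : IsRegularMap φ) (h0 : φ 0 = 0) (hne : ∃ P, φ P ≠ 0) (P Q : W.Point) :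
    φ (P + Q) = φ P + φ Q := by
  obtain ⟨N, hN, hN'⟩ := hφ.exists_pushforward h0 hne
  obtain ⟨a, b, ha, hb, hab⟩ := Point.add_eq_iff.1 (rfl : P + Q = P + Q)
  obtain ⟨a', ha', haa'⟩ := hN a ha
  obtain ⟨b', hb', hbb'⟩ := hN b hb
  refine (Point.add_eq_iff.2 ⟨a', b', ha', hb', ?_⟩).symm
  -- Pushing forward the relation a · I_P · I_Q = b · I_(P+Q) gives the same relation between the
  -- image points.
  have := congr_arg N hab
  rwa [_root_.map_mul, _root_.map_mul, _root_.map_mul, haa', hbb', hN', hN', hN'] at this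

/-- A nonconstant morphism of elliptic curves is surjective. -/
theorem IsRegularMap.surjective {φ : W.Point → W'.Point}
    (hφ : IsRegularMap φ) (h0 : φ 0 = 0) (hne : ∃ P, φ P ≠ 0) : Function.Surjective φ := by
  obtain ⟨f, hf, hreg, hdom⟩ := hφ.exists_comorphism h0 hne
  let := f.toRingHom.toAlgebra
  have : FaithfulSMul W'.CoordinateRing W.FunctionField :=
    (faithfulSMul_iff_algebraMap_injective _ _).2 hf
  rintro (_ | ⟨a, b, hab⟩)
  · exact ⟨0, h0⟩
  have hab' := W'.equation_iff_nonsingular.2 hab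
  have hm' := XYIdeal_isMaximal hab'
  obtain ⟨V, hV, hV'⟩ := ValuationSubring.exists_dominates (F := W.FunctionField) hm'.ne_top
  have hR := hreg V hV
  -- The center of V on the source; it will be the ideal of the preimage.
  let p : Ideal W.CoordinateRing :=
    { carrier := {r | V.valuation (algebraMap _ W.FunctionField r) < 1}
      add_mem' := fun hr hs => by
        rw [Set.mem_ofPred_eq, _root_.map_add]
        exact V.valuation.map_add_lt hr hs
      zero_mem' := by simp
      smul_mem' := fun c r hr => by
        rw [Set.mem_ofPred_eq, smul_eq_mul, _root_.map_mul]
        exact ValuationSubring.valuation_mul_lt_one (hR c) hr }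
  have hp : V.Dominates p := ⟨hR, fun r hr => hr⟩
  have hpp : p.IsPrime := by
    refine ⟨hp.ne_top, fun {r s} hrs => ?_⟩
    by_contra! h
    have h1 := (hR r).antisymm (not_lt.1 h.1)
    have h2 := (hR s).antisymm (not_lt.1 h.2)
    have h3 : V.valuation (algebraMap _ W.FunctionField (r * s)) < 1 := hrs
    rw [_root_.map_mul, _root_.map_mul, h1, h2, one_mul] at h3
    exact h3.ne rfl
  -- If p were zero, every nonzero element of F would be a unit of V, but the image of X - a is a
  -- nonzero element of the maximal ideal.
  have hp0 : p ≠ ⊥ := by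
    intro hp0
    have hunit {r : W.CoordinateRing} (hr : r ≠ 0) :
        V.valuation (algebraMap _ W.FunctionField r) = 1 :=
      (hR r).antisymm (not_lt.1 fun h => hr (by
        have : r ∈ p := h
        rwa [hp0, Ideal.mem_bot] at this))
    have h1 := hV' (XClass W' a) (Ideal.subset_span (Set.mem_insert _ _))
    obtain ⟨r, s, hs, hrs⟩ := IsFractionRing.div_surjective (A := W.CoordinateRing)
      (algebraMap W'.CoordinateRing W.FunctionField (XClass W' a))
    have hr : r ≠ 0 := by
      rintro rfl
      rw [_root_.map_zero, zero_div] at hrs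
      exact XClass_ne_zero (W' := W') a (hf (hrs.symm.trans (_root_.map_zero f).symm))
    rw [← hrs, map_div₀, hunit hr, hunit (nonZeroDivisors.ne_zero hs), div_one] at h1
    exact h1.ne rfl
  obtain ⟨x, y, h, hxy⟩ := exists_eq_XYIdeal (hpp.isMaximal hp0)
  have h' := W.equation_iff_nonsingular.1 h
  have hd := hdom V x y h' (hxy ▸ hp)
  refine ⟨.some x y h', ?_⟩
  rcases hP : φ (.some x y h') with _ | ⟨a', b', hab''⟩
  · obtain ⟨r, hr⟩ := hd.1 hP
    exact (hr (hV r)).elim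
  · have hd2 := hd.2 a' b' hab'' hP
    have hab3 := W'.equation_iff_nonsingular.2 hab''
    have heq : XYIdeal W' a' (C b') = XYIdeal W' a (C b) :=
      (XYIdeal_isMaximal hab3).eq_of_le hm'.ne_top fun r hr =>
        (ValuationSubring.Dominates.lt_one_iff hm' ⟨hV, hV'⟩).1 (hd2.2 r hr)
    have hx : XClass W' a' ∈ XYIdeal W' a (C b) := heq ▸ Ideal.subset_span (Set.mem_insert _ _)
    have hy : YClass W' (C b') ∈ XYIdeal W' a (C b) :=
      heq ▸ Ideal.subset_span (Set.mem_insert_of_mem _ rfl)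
    rw [mem_XYIdeal_iff hab'] at hx hy
    simp only [XClass_eq, YClass_eq, evalAt, _root_.map_sub, lift_xGen, lift_yGen, AlgHom.commutes,
      Algebra.algebraMap_self_apply, sub_eq_zero] at hx hy
    subst hx hy
    rfl

end WeierstrassCurve.Affine
end

/-! ### Tate modules under homomorphisms with finite kernel. -/

open scoped WeierstrassCurve.Affine

noncomputable section

namespace EllAdic

section TateModule

lemma tateModule_pow_nsmul {ℓ : ℕ} {A : Type*} [AddCommGroup A] (f : tateModule ℓ A) (k n : ℕ) :
    ℓ ^ k • f.1 (n + k) = f.1 n := by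
  induction k with
  | zero => simp
  | succ k ih => rw [pow_succ, mul_smul, ← add_assoc, f.2.2, ih]

variable {ℓ : ℕ} [hℓ : Fact ℓ.Prime] {A B : Type*} [AddCommGroup A] [AddCommGroup B]

/-- The Tate module is torsion-free. -/
lemma tateModule_eq_zero {N : ℕ} (hN : N ≠ 0) {f : tateModule ℓ A} (h : ∀ n, N • f.1 n = 0) :
    f = 0 := by
  -- The order of the component is ℓ ^ j ≤ N, and j < ℓ ^ j, so the uniform exponent N suffices.
  -- Going N levels up then kills every component.
  have key (m : ℕ) : ℓ ^ N • f.1 m = 0 := by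
    obtain ⟨j, -, hj⟩ := (Nat.dvd_prime_pow hℓ.out).1 (addOrderOf_dvd_of_nsmul_eq_zero (f.2.1 m))
    refine addOrderOf_dvd_iff_nsmul_eq_zero.1 (hj ▸ pow_dvd_pow ℓ ?_)
    exact (Nat.lt_pow_self hℓ.out.one_lt).le.trans
      (hj ▸ Nat.le_of_dvd (Nat.pos_of_ne_zero hN) (addOrderOf_dvd_of_nsmul_eq_zero (h m)))
  ext n
  rw [← tateModule_pow_nsmul f N n, key]
  rfl

lemma tateMap_eq_zero {g : A →+ B} [Finite g.ker] {f : tateModule ℓ A}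
    (h : tateMap (ℓ := ℓ) g f = 0) : f = 0 := by
  refine tateModule_eq_zero (N := Nat.card g.ker) Nat.card_pos.ne' fun n => ?_
  have hn : g (f.1 n) = 0 := congr_fun (congr_arg Subtype.val h) n
  exact congr_arg Subtype.val (card_nsmul_eq_zero' (x := (⟨f.1 n, hn⟩ : g.ker)))

/-- A surjective homomorphism with finite kernel has finite cokernel on Tate modules. -/
lemma exists_tateMap_eq {g : A →+ B} [Finite g.ker] (hg : Function.Surjective g)
    (t : tateModule ℓ B) : ∃ f : tateModule ℓ A, tateMap (ℓ := ℓ) g f = Nat.card g.ker • t := by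
  -- Arbitrary preimages satisfy the Tate relations only up to the kernel; multiplication by its
  -- order removes the error.
  choose h hh using fun n => hg (t.1 n)
  have hker {x : A} (hx : g x = 0) : Nat.card g.ker • x = 0 :=
    congr_arg Subtype.val (card_nsmul_eq_zero' (x := (⟨x, hx⟩ : g.ker)))
  refine ⟨⟨fun n => Nat.card g.ker • h n, fun n => ?_, fun n => ?_⟩, ?_⟩
  · rw [smul_comm]
    exact hker (by rw [map_nsmul, hh, t.2.1])
  · rw [smul_comm, ← sub_eq_zero, ← smul_sub]
    exact hker (by rw [map_sub, map_nsmul, hh, hh, t.2.2, sub_self])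
  · ext n
    change g (Nat.card g.ker • h n) = _
    rw [map_nsmul, hh]
    rfl

/-- Whether an endomorphism acts as `-1` on the Tate module does not change along an equivariant
surjection with finite kernel. -/
lemma tateMap_eq_neg_iff {g : A →+ B} [Finite g.ker] (hg : Function.Surjective g) {σ : A →+ A}
    {τ : B →+ B} (h : ∀ x, g (σ x) = τ (g x)) :
    (∀ f : tateModule ℓ A, tateMap (ℓ := ℓ) σ f = -f) ↔
      ∀ f : tateModule ℓ B, tateMap (ℓ := ℓ) τ f = -f := by
  have hcomm (f : tateModule ℓ A) : tateMap (ℓ := ℓ) g (tateMap (ℓ := ℓ) σ f) =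
      tateMap (ℓ := ℓ) τ (tateMap (ℓ := ℓ) g f) := by
    ext n
    exact h _
  refine ⟨fun H t => ?_, fun H f => ?_⟩
  -- A multiple of t lifts, so that multiple of τ t + t vanishes; torsion-freeness finishes.
  · obtain ⟨f, hf⟩ := exists_tateMap_eq hg t
    have h1 := hcomm f
    rw [H, map_neg, hf, map_nsmul, eq_comm, eq_neg_iff_add_eq_zero, ← smul_add] at h1
    exact eq_neg_iff_add_eq_zero.2 (tateModule_eq_zero Nat.card_pos.ne'
      fun n => congr_fun (congr_arg Subtype.val h1) n)
  · have h1 := hcomm f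
    rw [H, eq_neg_iff_add_eq_zero, ← map_add] at h1
    exact eq_neg_iff_add_eq_zero.2 (tateMap_eq_zero h1)

end TateModule

/-! ### Isogenies as Galois-equivariant homomorphisms. -/

section Galois

variable {E E' : WeierstrassCurve ℚ}

lemma homCoords_eq_projCoords (P : Pts E) :
    homCoords P = WeierstrassCurve.Affine.Point.projCoords P := by
  cases P <;> rfl

lemma eq_of_homCoords_eq {P Q : Pts E} {c d : Qbar} (hc : c ≠ 0) (hd : d ≠ 0)
    (h : ∀ i, c * homCoords P i = d * homCoords Q i) : P = Q := by
  rcases P with _ | ⟨x, y, hP⟩ <;> rcases Q with _ | ⟨x', y', hQ⟩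
  · rfl
  · have := h 2
    simp only [homCoords, Matrix.cons_val, mul_zero, mul_one] at this
    exact (hd this.symm).elim
  · have := h 2
    simp only [homCoords, Matrix.cons_val, mul_zero, mul_one] at this
    exact (hc this).elim
  · have h0 := h 0
    have h1 := h 1
    have h2 := h 2
    simp only [homCoords, Matrix.cons_val, mul_one] at h0 h1 h2
    subst h2
    obtain rfl := mul_left_cancel₀ hc h0
    obtain rfl := mul_left_cancel₀ hc h1
    rfl

lemma homCoords_galPt (σ : GQ) (P : Pts E) (i : Fin 3) :
    homCoords (galPt E σ P) i = σ (homCoords P i) := by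
  rcases P with _ | ⟨x, y, h⟩
  · change ![0, 1, 0] i = σ (![0, 1, 0] i)
    fin_cases i <;> simp
  · change ![σ x, σ y, 1] i = σ (![x, y, 1] i)
    fin_cases i <;> simp

/-- A chart at P has rational coefficients, so it is also nonvanishing at σ P, and evaluating it
there is applying σ to its values at P. -/
lemma IsMorphism.map_galPt {φ : Pts E → Pts E'} (hφ : IsMorphism φ) (σ : GQ) (P : Pts E) :
    φ (galPt E σ P) = galPt E' σ (φ P) := by
  obtain ⟨d, F, -, ⟨i, hi⟩, hF⟩ := hφ P
  have hσ (i : Fin 3) : MvPolynomial.aeval (homCoords (galPt E σ P)) (F i) =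
      σ (MvPolynomial.aeval (homCoords P) (F i)) := by
    rw [show homCoords (galPt E σ P) = fun i => σ (homCoords P i) from
      funext (homCoords_galPt σ P)]
    exact (MvPolynomial.comp_aeval_apply (homCoords P) σ.toAlgHom (F i)).symm
  obtain ⟨c, hc, hc'⟩ := hF P ⟨i, hi⟩
  obtain ⟨c', hc0', hc''⟩ := hF (galPt E σ P) ⟨i, by rw [hσ]; simpa using hi⟩
  refine eq_of_homCoords_eq hc0' ((map_ne_zero σ).2 hc) fun j => ?_
  rw [← hc'', hσ, hc', map_mul, homCoords_galPt]

lemma IsMorphism.isRegularMap {φ : Pts E → Pts E'} (hφ : IsMorphism φ) :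
    WeierstrassCurve.Affine.IsRegularMap φ := by
  intro P
  obtain ⟨d, F, hd, hP, hF⟩ := hφ P
  simp only [homCoords_eq_projCoords] at hP hF
  refine ⟨d, fun i => MvPolynomial.map (algebraMap ℚ Qbar) (F i),
    ⟨fun i => (hd i).map _, fun Q hQ => ?_⟩, ?_⟩
  · simp only [MvPolynomial.aeval_map_algebraMap] at hQ ⊢
    exact hF Q hQ
  · simpa only [MvPolynomial.aeval_map_algebraMap] using hP

lemma Isogeny.exists_ne_zero (φ : Isogeny E E') : ∃ P, φ.toFun P ≠ 0 := by
  obtain ⟨P, Q, hPQ⟩ := φ.nonconstant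
  by_contra! h
  exact hPQ ((h P).trans (h Q).symm)

variable [E.IsElliptic] [E'.IsElliptic]

instance : WeierstrassCurve.IsElliptic (E⁄Qbar) :=
  inferInstanceAs (E.map (algebraMap ℚ Qbar)).IsElliptic

/-- An isogeny as a homomorphism on points. -/
def Isogeny.toAddMonoidHom (φ : Isogeny E E') : Pts E →+ Pts E' where
  toFun := φ.toFun
  map_zero' := φ.map_zero
  map_add' := φ.isMorphism.isRegularMap.map_add φ.map_zero φ.exists_ne_zero

lemma Isogeny.surjective (φ : Isogeny E E') : Function.Surjective φ.toAddMonoidHom :=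
  φ.isMorphism.isRegularMap.surjective φ.map_zero φ.exists_ne_zero

end Galois

/-! ### Membership of -1 in the image of Galois. -/

section Representation

variable (E : WeierstrassCurve ℚ) (ℓ : ℕ) [Fact ℓ.Prime]

lemma neg_one_mem_range_adicRep_iff :
    -1 ∈ (adicRep E ℓ).range ↔ ∃ σ : GQ, ∀ f : Tate E ℓ, tateMap (galPt E σ) f = -f := by
  refine exists_congr fun σ => ?_
  rw [Units.ext_iff, LinearMap.ext_iff]
  rfl

/-- The matrix representation is the abstract one followed by an injective ring map, which sends -1
to -1 whatever the basis. -/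
lemma neg_one_mem_range_adicRepMatrix_iff (b : Module.Basis (Fin 2) ℤ_[ℓ] (Tate E ℓ)) :
    -1 ∈ (adicRepMatrix E ℓ b).range ↔ -1 ∈ (adicRep E ℓ).range := by
  refine exists_congr fun σ => ?_
  have h : (-1 : Matrix.GeneralLinearGroup (Fin 2) ℤ_[ℓ]) =
      Units.map (LinearMap.toMatrixAlgEquiv b :
        Module.End ℤ_[ℓ] (Tate E ℓ) →* Matrix (Fin 2) (Fin 2) ℤ_[ℓ]) (-1) :=
    Units.ext (by simp)
  rw [h]
  exact (Units.map_injective (LinearMap.toMatrixAlgEquiv b).injective).eq_iff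

end Representation

end EllAdic

end
open EllAdic in
theorem mainTheorem8 (ℓ : ℕ) [Fact ℓ.Prime]
    (E E' : WeierstrassCurve ℚ) [E.IsElliptic] [E'.IsElliptic]
    (φ : Isogeny E E') (H : AddSubgroup (Pts E)) (hker : φ.ker = H)
    (hfin : Finite H) (hcyc : IsAddCyclic H) (hrat : IsRational H) :
    (-1 ∈ (adicRep E ℓ).range ↔ -1 ∈ (adicRep E' ℓ).range) ∧
    ∀ (b : Module.Basis (Fin 2) ℤ_[ℓ] (Tate E ℓ)) (b' : Module.Basis (Fin 2) ℤ_[ℓ] (Tate E' ℓ)),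
      -1 ∈ (adicRepMatrix E ℓ b).range ↔ -1 ∈ (adicRepMatrix E' ℓ b').range := by
  have hH : φ.toAddMonoidHom.ker = H := SetLike.coe_injective hker
  have : Finite φ.toAddMonoidHom.ker := hH ▸ hfin
  have key : -1 ∈ (adicRep E ℓ).range ↔ -1 ∈ (adicRep E' ℓ).range := by
    rw [neg_one_mem_range_adicRep_iff, neg_one_mem_range_adicRep_iff]
    -- The same σ works for both curves.
    exact exists_congr fun σ => tateMap_eq_neg_iff φ.surjective (φ.isMorphism.map_galPt σ)
  refine ⟨key, fun b b' => ?_⟩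
  rw [neg_one_mem_range_adicRepMatrix_iff, neg_one_mem_range_adicRepMatrix_iff, key]
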